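/- Let $0\le k\le m\le n$ be integers and let $M\subset\mathbb{R}^n$ be a compact smooth $k$-dimensional submanifold without boundary, i.e. $M$ is compact and every point of $M$ has a relatively open neighbourhood in $M$ that is diffeomorphic to $\mathbb{R}^k$ (a map on a subset of a Euclidean space is smooth if it is locally the restriction of a smooth map on an open set). For a subset $S$ of a Euclidean space $E$ and $x\in S$, let $T_xS\subset E$ be the linear span of the velocities $\gamma'(0)$ of all smooth curves $\gamma:[-1,1]\to S$ with $\gamma(0)=x$, let $N_xS=(T_xS)^{\perp}$, and for $r>0$ let $N^rS=\{(x,v): x\in S,\ v\in N_xS,\ \|v\|_2<r\}$ be the open normal bundle of radius $r$. The bundle $N^rS$ is called embedded in $E$ if the map $(x,v)\mapsto x+v$ on $N^rS$ is a smooth embedding, i.e. a homeomorphism onto its image that is also an immersion (its differential kills no nonzero velocity $c'(0)$ of a smooth curve $c:[-1,1]\to N^rS$). The reach $\mathrm{rch}(S)\in[0,\infty]$ is the largest number $\rho$ such that $N^rS$ is embedded in $E$ for all $0<r<\rho$. Let $\Phi:\mathbb{R}^n\to\mathbb{R}^m$ be a linear map of rank $m$ whose $m$ nonzero singular values lie in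 an interval $[\sigma_{\min},\sigma_{\max}]\subset(0,\infty)$, and suppose that $\Phi$ is bi-Lipschitz on $M$: there are real constants $l>0$ and $u$ with $$l\,\|x-y\|_2\le\|\Phi x-\Phi y\|_2\le u\,\|x-y\|_2\qquad\text{for all }x,y\in M.$$ If $m=n$, then $$\mathrm{rch}(\Phi(M))\ \ge\ \frac{\sigma_{\min}^2}{\sigma_{\max}}\cdot\mathrm{rch}(M),$$ and if $m<n$, then $$\mathrm{rch}(\Phi(M))\ \ge\ \frac{\sigma_{\min}^2\,l^2}{\sigma_{\max}^3}\cdot\mathrm{rch}(M).$$ -/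

import Mathlib

open Set Topology
open scoped ContDiff ENNReal

/-- `M` is a smooth `k`-dimensional (embedded, boundaryless) submanifold of the normed space `E`:
every point of `M` has a relatively open neighbourhood `M ∩ U` in `M` that is diffeomorphic to
`ℝᵏ`. Here `ψ : ℝᵏ → M ∩ U` is the smooth parametrization and `φ` its smooth inverse (a map on a
subset of `E` being smooth when it is the restriction of a smooth map on an open set). Since all
the charts are restrictions of smooth maps of `E`, transition maps are smooth. -/
def IsSmoothSubmanifold {E : Type*} [NormedAddCommGroup E] [NormedSpace ℝ E]
    (k : ℕ) (M : Set E) : Prop :=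
  ∀ x ∈ M, ∃ (U : Set E) (ψ : EuclideanSpace ℝ (Fin k) → E) (φ : E → EuclideanSpace ℝ (Fin k)),
    IsOpen U ∧ x ∈ U ∧
    ContDiff ℝ ∞ ψ ∧ ContDiffOn ℝ ∞ φ U ∧
    (∀ a, ψ a ∈ M ∩ U) ∧ (∀ a, φ (ψ a) = a) ∧ (∀ y ∈ M ∩ U, ψ (φ y) = y)

/-- The velocities `γ'(0)` of the smooth curves `γ : [-1,1] → S` with `γ(0) = x`. -/
def tangentVectors {E : Type*} [NormedAddCommGroup E] [NormedSpace ℝ E]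
    (S : Set E) (x : E) : Set E :=
  {v | ∃ γ : ℝ → E, ContDiffOn ℝ ∞ γ (Icc (-1) 1) ∧ (∀ t ∈ Icc (-1 : ℝ) 1, γ t ∈ S) ∧
    γ 0 = x ∧ HasDerivAt γ v 0}

/-- The tangent subspace of `S` at `x`: the span of the velocities of smooth curves. -/
def tangentSubspace {E : Type*} [NormedAddCommGroup E] [NormedSpace ℝ E]
    (S : Set E) (x : E) : Submodule ℝ E :=
  Submodule.span ℝ (tangentVectors S x)

/-- The normal subspace of `S` at `x`. -/
noncomputable def normalSubspace {E : Type*} [NormedAddCommGroup E] [InnerProductSpace ℝ E]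
    (S : Set E) (x : E) : Submodule ℝ E :=
  (tangentSubspace S x)ᗮ

/-- The open normal bundle of `S` of radius `r`, as a subset of `E × E`: the pairs `(x, v)` of a
point `x` of `S` and a normal vector `v` at `x` of length less than `r`. -/
def openNormalBundle {E : Type*} [NormedAddCommGroup E] [InnerProductSpace ℝ E]
    (S : Set E) (r : ℝ) : Set (E × E) :=
  {p | p.1 ∈ S ∧ p.2 ∈ normalSubspace S p.1 ∧ ‖p.2‖ < r}

/-- The open normal bundle of `S` of radius `r` is embedded in `E` by the (linear, hence smooth)
map `(x, v) ↦ x + v`: this map is a homeomorphism onto its image, and it is an immersion, i.e. its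
differential `(a, b) ↦ a + b` kills no nonzero tangent vector of the bundle. -/
def NormalBundleEmbedded {E : Type*} [NormedAddCommGroup E] [InnerProductSpace ℝ E]
    (S : Set E) (r : ℝ) : Prop :=
  IsEmbedding (fun p : openNormalBundle S r => (p : E × E).1 + (p : E × E).2) ∧
  ∀ p ∈ openNormalBundle S r, ∀ t ∈ tangentVectors (openNormalBundle S r) p,
    t.1 + t.2 = 0 → t = 0

/-- The reach of `S`, in `[0, ∞]`: the largest `ρ` such that the open normal bundle of `S` of
radius `r` is embedded for all `0 < r < ρ`. -/
noncomputable def reach {E : Type*} [NormedAddCommGroup E] [InnerProductSpace ℝ E]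
    (S : Set E) : ℝ≥0∞ :=
  sSup {ρ : ℝ≥0∞ | ∀ r : ℝ, 0 < r → ENNReal.ofReal r < ρ → NormalBundleEmbedded S r}

open scoped RealInnerProductSpace

section NormalBundle

variable {E : Type*} [NormedAddCommGroup E] [InnerProductSpace ℝ E] {S : Set E}

/-! The reach is controlled by the tangent-ball inequality `2 * t * ⟪v, y - x⟫ ≤ ‖v‖ * ‖y - x‖ ^ 2`
for `v` normal at `x`. An embedded bundle of radius `R` gives it for `t < R`
(`inner_sub_le_of_normalBundleEmbedded`); conversely, the inequality at `ρ` makes every bundle of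
radius `r < ρ` embedded (`normalBundleEmbedded_of_inner_sub_le`).

The inequality passes through a linear map `T`: the adjoint pulls normals of the image back to
normals of `S` and has norm at most `C`, while `‖y - x‖ ≤ ‖T y - T x‖ / l`. Hence `t` becomes `t * l
^ 2 / C` (`mul_reach_le_reach_image`). Here `C = σmax`; for `m = n` one may take `l = σmin`. -/

theorem mem_normalSubspace_iff {x v : E} :
    v ∈ normalSubspace S x ↔ ∀ w ∈ tangentVectors S x, ⟪w, v⟫ = 0 := by
  rw [normalSubspace, Submodule.mem_orthogonal]
  refine ⟨fun h w hw ↦ h w (Submodule.subset_span hw), fun h w hw ↦ ?_⟩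
  induction hw using Submodule.span_induction with
  | mem w hw => exact h w hw
  | zero => exact inner_zero_left v
  | add a b _ _ ha hb => rw [inner_add_left, ha, hb, add_zero]
  | smul c a _ ha => rw [real_inner_smul_left, ha, mul_zero]

/-- The vector from a nearest point of `S` to `p` is normal to `S`. -/
theorem sub_mem_normalSubspace_of_isMinOn {p y : E} (hmin : IsMinOn (fun z ↦ ‖p - z‖) S y) :
    p - y ∈ normalSubspace S y := by
  refine mem_normalSubspace_iff.2 ?_
  rintro w ⟨γ, -, hγS, hγ0, hγ⟩
  have hloc : IsLocalMin (fun t ↦ ‖p - γ t‖ ^ 2) 0 := by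
    filter_upwards [Icc_mem_nhds (show (-1 : ℝ) < 0 by norm_num) one_pos] with t ht
    have h : ‖p - y‖ ≤ ‖p - γ t‖ := hmin (hγS t ht)
    rw [hγ0]
    gcongr
  have h := hloc.hasDerivAt_eq_zero (hγ.const_sub p).norm_sq
  rw [hγ0, inner_neg_right, real_inner_comm] at h
  linarith

/-- If the normal bundle of radius `R` of a compact set `S` is embedded, then `S` lies outside the
open balls of radius `t < R` that are tangent to it. -/
theorem inner_sub_le_of_normalBundleEmbedded (hS : IsCompact S) {R t : ℝ}
    (hR : NormalBundleEmbedded S R) (ht : 0 < t) (htR : t < R) {x y v : E} (hx : x ∈ S)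
    (hy : y ∈ S) (hv : v ∈ normalSubspace S x) :
    2 * t * ⟪v, y - x⟫ ≤ ‖v‖ * ‖y - x‖ ^ 2 := by
  rcases eq_or_ne v 0 with rfl | hv0
  · simp
  have hvpos : 0 < ‖v‖ := norm_pos_iff.2 hv0
  set w : E := (t / ‖v‖) • v with hw
  have hwN : w ∈ normalSubspace S x := Submodule.smul_mem _ _ hv
  have hwn : ‖w‖ = t := by
    rw [hw, norm_smul, Real.norm_of_nonneg (by positivity), div_mul_cancel₀ _ hvpos.ne']
  obtain ⟨z, hz, hmin⟩ := hS.exists_isMinOn ⟨x, hx⟩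
    (f := fun z ↦ ‖x + w - z‖) (by fun_prop)
  have hzx : ‖x + w - z‖ ≤ t := by
    have h : ‖x + w - z‖ ≤ ‖x + w - x‖ := hmin hx
    rwa [add_sub_cancel_left, hwn] at h
  -- Both `(z, x + w - z)` and `(x, w)` lie in the bundle and have sum `x + w`, so the nearest point
  -- `z` is `x` itself.
  have hinj := @hR.1.injective
    ⟨(z, x + w - z), hz, sub_mem_normalSubspace_of_isMinOn hmin, hzx.trans_lt htR⟩
    ⟨(x, w), hx, hwN, hwn.trans_lt htR⟩ (add_sub_cancel z (x + w))
  obtain rfl : z = x := congrArg (fun p ↦ p.1.1) hinj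
  have hyz : ‖z + w - z‖ ≤ ‖z + w - y‖ := hmin hy
  rw [add_sub_cancel_left, show z + w - y = w - (y - z) by abel] at hyz
  have hsq : ‖w‖ ^ 2 ≤ ‖w - (y - z)‖ ^ 2 := by gcongr
  rw [norm_sub_sq_real, hw, real_inner_smul_left] at hsq
  have h : 2 * (t / ‖v‖ * ⟪v, y - z⟫) ≤ ‖y - z‖ ^ 2 := by linarith
  calc 2 * t * ⟪v, y - z⟫ = ‖v‖ * (2 * (t / ‖v‖ * ⟪v, y - z⟫)) := by field_simp
    _ ≤ ‖v‖ * ‖y - z‖ ^ 2 := by gcongr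

/-- If `S` lies outside the open balls of radius `ρ > r` that are tangent to it, then its normal
bundle of radius `r` is embedded. -/
theorem normalBundleEmbedded_of_inner_sub_le {r ρ : ℝ} (hr : 0 < r) (hrρ : r < ρ)
    (h : ∀ x ∈ S, ∀ y ∈ S, ∀ v ∈ normalSubspace S x,
      2 * ρ * ⟪v, y - x⟫ ≤ ‖v‖ * ‖y - x‖ ^ 2) :
    NormalBundleEmbedded S r := by
  have hρ : 0 < ρ := hr.trans hrρ
  -- `K` is a Lipschitz constant for the foot-point map `x + v ↦ x`: pairing the difference of two
  -- sums with `a - b`, the normal parts cost at most `r / ρ * ‖a - b‖ ^ 2`.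
  set K : ℝ := ρ / (ρ - r) with hK
  have hd : 0 < ρ - r := sub_pos.2 hrρ
  have hK0 : 0 < K := div_pos hρ hd
  have hfst : ∀ p ∈ openNormalBundle S r, ∀ q ∈ openNormalBundle S r,
      ‖p.1 - q.1‖ ≤ K * ‖(p.1 + p.2) - (q.1 + q.2)‖ := by
    rintro ⟨a, v⟩ ⟨ha, hv, hvr⟩ ⟨b, w⟩ ⟨hb, hw, hwr⟩
    dsimp only at *
    have h1 := h a ha b hb v hv
    have h2 := h b hb a ha w hw
    rw [← neg_sub a b, norm_neg, inner_neg_right] at h1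
    have h3 : ⟪(a + v) - (b + w), a - b⟫ = ‖a - b‖ ^ 2 + ⟪v, a - b⟫ - ⟪w, a - b⟫ := by
      rw [show (a + v) - (b + w) = (a - b) + v - w by abel, inner_sub_left, inner_add_left,
        real_inner_self_eq_norm_sq]
    have h4 := real_inner_le_norm ((a + v) - (b + w)) (a - b)
    have h5 : (‖v‖ + ‖w‖) * ‖a - b‖ ^ 2 ≤ (2 * r) * ‖a - b‖ ^ 2 := by
      gcongr
      linarith
    have h6 : (ρ - r) * ‖a - b‖ ^ 2 ≤ ρ * (‖(a + v) - (b + w)‖ * ‖a - b‖) := by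
      nlinarith [mul_le_mul_of_nonneg_left h4 hρ.le]
    rcases (norm_nonneg (a - b)).eq_or_lt with h0 | h0
    · rw [← h0]
      positivity
    · rw [hK, div_mul_eq_mul_div, le_div_iff₀ hd]
      refine le_of_mul_le_mul_right ?_ h0
      linarith
  have hdist : ∀ p ∈ openNormalBundle S r, ∀ q ∈ openNormalBundle S r,
      ‖p - q‖ ≤ (1 + K) * ‖(p.1 + p.2) - (q.1 + q.2)‖ := by
    intro p hp q hq
    have h1 := hfst p hp q hq
    have h2 : ‖p.2 - q.2‖ ≤ ‖(p.1 + p.2) - (q.1 + q.2)‖ + ‖p.1 - q.1‖ := by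
      rw [show p.2 - q.2 = (p.1 + p.2) - (q.1 + q.2) - (p.1 - q.1) by abel]
      exact norm_sub_le _ _
    rw [Prod.norm_def, Prod.fst_sub, Prod.snd_sub]
    have h3 := norm_nonneg ((p.1 + p.2) - (q.1 + q.2))
    exact max_le (by linarith) (by linarith)
  refine ⟨?_, ?_⟩
  · have hanti : AntilipschitzWith (1 + K).toNNReal
        (fun p : openNormalBundle S r ↦ (p : E × E).1 + (p : E × E).2) := by
      refine AntilipschitzWith.of_le_mul_dist fun p q ↦ ?_
      rw [Real.coe_toNNReal _ (by positivity), Subtype.dist_eq, dist_eq_norm, dist_eq_norm]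
      exact hdist p p.2 q q.2
    have hunif : UniformContinuous
        (fun p : openNormalBundle S r ↦ (p : E × E).1 + (p : E × E).2) :=
      (uniformContinuous_fst.comp uniformContinuous_subtype_val).add
        (uniformContinuous_snd.comp uniformContinuous_subtype_val)
    exact ⟨(hanti.isUniformInducing hunif).isInducing, hanti.injective⟩
  -- By `hdist`, a curve in the bundle moves no faster than a constant times its image under the
  -- sum; if the image has velocity zero, so does the curve.
  · rintro p hp t ⟨c, -, hcS, hc0, hc⟩ ht
    have hsum : HasDerivAt (fun s ↦ (c s).1 + (c s).2) 0 0 := by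
      rw [← ht]
      exact ((ContinuousLinearMap.fst ℝ E E + ContinuousLinearMap.snd ℝ E E).hasFDerivAt
        (x := c 0)).comp_hasDerivAt 0 hc
    have hO : (fun s ↦ c s - c 0) =O[𝓝 0]
        (fun s ↦ ((c s).1 + (c s).2) - ((c 0).1 + (c 0).2)) := by
      refine Asymptotics.IsBigO.of_bound (1 + K) ?_
      filter_upwards [Icc_mem_nhds (show (-1 : ℝ) < 0 by norm_num) one_pos] with s hs
      exact hdist _ (hcS s hs) _ (hcS 0 (by norm_num))
    have hzero : HasDerivAt c 0 0 := by
      rw [hasDerivAt_iff_isLittleO] at hsum ⊢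
      simp only [smul_zero, sub_zero] at hsum ⊢
      exact hO.trans_isLittleO (by simpa using hsum)
    exact hc.unique hzero

theorem normalBundleEmbedded_of_lt_reach {r : ℝ} (hr : 0 < r)
    (h : ENNReal.ofReal r < reach S) : NormalBundleEmbedded S r := by
  obtain ⟨ρ, hρ, hlt⟩ := lt_sSup_iff.1 h
  exact hρ r hr hlt

end NormalBundle

section LinearImage

variable {E F : Type*} [NormedAddCommGroup E] [InnerProductSpace ℝ E] [FiniteDimensional ℝ E]
  [NormedAddCommGroup F] [InnerProductSpace ℝ F]

theorem map_mem_tangentVectors_image (T : E →ₗ[ℝ] F) {S : Set E} {x v : E}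
    (hv : v ∈ tangentVectors S x) : T v ∈ tangentVectors (T '' S) (T x) := by
  obtain ⟨γ, hγ, hγS, hγ0, hγ'⟩ := hv
  refine ⟨fun t ↦ T (γ t), (LinearMap.toContinuousLinearMap T).contDiff.comp_contDiffOn hγ,
    fun t ht ↦ mem_image_of_mem T (hγS t ht), congrArg T hγ0, ?_⟩
  exact (LinearMap.toContinuousLinearMap T).hasFDerivAt.comp_hasDerivAt 0 hγ'

variable [FiniteDimensional ℝ F]

/-- Dual to `T` carrying tangent vectors to tangent vectors. -/
theorem adjoint_mem_normalSubspace (T : E →ₗ[ℝ] F) {S : Set E} {x : E} {v : F}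
    (hv : v ∈ normalSubspace (T '' S) (T x)) :
    LinearMap.adjoint T v ∈ normalSubspace S x := by
  refine mem_normalSubspace_iff.2 fun w hw ↦ ?_
  rw [LinearMap.adjoint_inner_right]
  exact mem_normalSubspace_iff.1 hv _ (map_mem_tangentVectors_image T hw)

theorem LinearMap.norm_adjoint_apply_le (T : E →ₗ[ℝ] F) {C : ℝ} (hC₀ : 0 ≤ C)
    (hC : ∀ x, ‖T x‖ ≤ C * ‖x‖) (v : F) : ‖LinearMap.adjoint T v‖ ≤ C * ‖v‖ := by
  rcases (norm_nonneg (LinearMap.adjoint T v)).eq_or_lt with h0 | h0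
  · rw [← h0]
    positivity
  · refine le_of_mul_le_mul_right ?_ h0
    calc ‖LinearMap.adjoint T v‖ * ‖LinearMap.adjoint T v‖
        = ⟪T (LinearMap.adjoint T v), v⟫ := by
          rw [← LinearMap.adjoint_inner_right, real_inner_self_eq_norm_mul_norm]
      _ ≤ ‖T (LinearMap.adjoint T v)‖ * ‖v‖ := real_inner_le_norm _ _
      _ ≤ C * ‖LinearMap.adjoint T v‖ * ‖v‖ := by gcongr; exact hC _
      _ = C * ‖v‖ * ‖LinearMap.adjoint T v‖ := by ring

/-- The squared singular values are the eigenvalues of `T* T`, so `⟪x, T* T x⟫` is diagonal in its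
eigenbasis. -/
theorem LinearMap.norm_sq_apply_eq_sum_singularValues (T : E →ₗ[ℝ] F) (x : E) :
    ‖T x‖ ^ 2 = ∑ i : Fin (Module.finrank ℝ E), T.singularValues i ^ 2 *
      ⟪T.isSymmetric_adjoint_comp_self.eigenvectorBasis rfl i, x⟫ ^ 2 := by
  set b := T.isSymmetric_adjoint_comp_self.eigenvectorBasis rfl with hb
  calc ‖T x‖ ^ 2 = ⟪x, (LinearMap.adjoint T ∘ₗ T) x⟫ := by
        rw [LinearMap.comp_apply, LinearMap.adjoint_inner_right, real_inner_self_eq_norm_sq]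
    _ = ∑ i, ⟪x, b i⟫ * ⟪b i, (LinearMap.adjoint T ∘ₗ T) x⟫ := (b.sum_inner_mul_inner _ _).symm
    _ = _ := by
      refine Finset.sum_congr rfl fun i _ ↦ ?_
      rw [← T.isSymmetric_adjoint_comp_self (b i) x, hb,
        T.isSymmetric_adjoint_comp_self.apply_eigenvectorBasis, ← hb, T.sq_singularValues_fin rfl,
        RCLike.ofReal_real_eq_id, id_eq, real_inner_smul_left, real_inner_comm]
      ring

theorem LinearMap.norm_apply_le_of_singularValues_le (T : E →ₗ[ℝ] F) {C : ℝ} (hC : 0 ≤ C)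
    (h : ∀ i < Module.finrank ℝ E, T.singularValues i ≤ C) (x : E) : ‖T x‖ ≤ C * ‖x‖ := by
  refine le_of_sq_le_sq ?_ (by positivity)
  rw [T.norm_sq_apply_eq_sum_singularValues, mul_pow,
    ← (T.isSymmetric_adjoint_comp_self.eigenvectorBasis rfl).sum_sq_inner_right x, Finset.mul_sum]
  gcongr with i
  · exact T.singularValues_nonneg i
  · exact h i i.2

theorem LinearMap.le_norm_apply_of_le_singularValues (T : E →ₗ[ℝ] F) {c : ℝ} (hc : 0 ≤ c)
    (h : ∀ i < Module.finrank ℝ E, c ≤ T.singularValues i) (x : E) : c * ‖x‖ ≤ ‖T x‖ := by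
  refine le_of_sq_le_sq ?_ (norm_nonneg _)
  rw [T.norm_sq_apply_eq_sum_singularValues, mul_pow,
    ← (T.isSymmetric_adjoint_comp_self.eigenvectorBasis rfl).sum_sq_inner_right x, Finset.mul_sum]
  gcongr with i
  exact h i i.2

/-- A linear map that is bounded by `C` and expands the distances in the compact set `S` by at least
`l` decreases the reach of `S` at most by the factor `l ^ 2 / C`. -/
theorem mul_reach_le_reach_image (T : E →ₗ[ℝ] F) {S : Set E} (hS : IsCompact S) {C l : ℝ}
    (hC : 0 < C) (hl : 0 < l) (hT : ∀ x, ‖T x‖ ≤ C * ‖x‖)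
    (hlow : ∀ x ∈ S, ∀ y ∈ S, l * ‖x - y‖ ≤ ‖T x - T y‖) :
    ENNReal.ofReal (l ^ 2 / C) * reach S ≤ reach (T '' S) := by
  refine le_sSup fun r hr hrlt ↦ ?_
  have hc : 0 < l ^ 2 / C := by positivity
  have hlt : ENNReal.ofReal (r / (l ^ 2 / C)) < reach S := by
    rw [ENNReal.ofReal_div_of_pos hc]
    exact ENNReal.div_lt_of_lt_mul' hrlt
  -- Two intermediate radii are needed: the ball inequality loses `t < R`, and its converse needs `t
  -- * (l ^ 2 / C) > r`.
  obtain ⟨R, hR0, hR1, hR2⟩ := ENNReal.lt_iff_exists_real_btwn.1 hlt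
  have hrR : r / (l ^ 2 / C) < R := (ENNReal.ofReal_lt_ofReal_iff_of_nonneg (by positivity)).1 hR1
  obtain ⟨t, ht1, ht2⟩ := exists_between hrR
  have ht0 : 0 < t := lt_trans (by positivity) ht1
  have hemb := normalBundleEmbedded_of_lt_reach (ht0.trans ht2) hR2
  refine normalBundleEmbedded_of_inner_sub_le (ρ := t * (l ^ 2 / C)) hr ((div_lt_iff₀ hc).1 ht1) ?_
  rintro _ ⟨x, hx, rfl⟩ _ ⟨y, hy, rfl⟩ v hv
  have h1 := inner_sub_le_of_normalBundleEmbedded hS hemb ht0 ht2 hx hy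
    (adjoint_mem_normalSubspace T hv)
  rw [LinearMap.adjoint_inner_left, map_sub] at h1
  have h2 := T.norm_adjoint_apply_le hC.le hT v
  have h3 : (l * ‖y - x‖) ^ 2 ≤ ‖T y - T x‖ ^ 2 := by
    gcongr
    exact hlow y hy x hx
  calc 2 * (t * (l ^ 2 / C)) * ⟪v, T y - T x⟫
      = l ^ 2 / C * (2 * t * ⟪v, T y - T x⟫) := by ring
    _ ≤ l ^ 2 / C * (C * ‖v‖ * ‖y - x‖ ^ 2) := by
      refine mul_le_mul_of_nonneg_left (h1.trans ?_) hc.le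
      gcongr
    _ = ‖v‖ * (l * ‖y - x‖) ^ 2 := by field_simp
    _ ≤ ‖v‖ * ‖T y - T x‖ ^ 2 := by gcongr

end LinearImage

theorem mainTheorem1 (n m k : ℕ) (hkm : k ≤ m) (hmn : m ≤ n)
    (M : Set (EuclideanSpace ℝ (Fin n)))
    (hM : IsSmoothSubmanifold k M) (hMc : IsCompact M)
    (Φ : EuclideanSpace ℝ (Fin n) →ₗ[ℝ] EuclideanSpace ℝ (Fin m))
    (hrank : Module.finrank ℝ (LinearMap.range Φ) = m)
    (σmin σmax : ℝ) (hσ : 0 < σmin) (hσ' : σmin ≤ σmax)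
    (hsing : ∀ i < m, Φ.singularValues i ∈ Icc σmin σmax)
    (l u : ℝ) (hl : 0 < l)
    (hlip : ∀ x ∈ M, ∀ y ∈ M,
      l * ‖x - y‖ ≤ ‖Φ x - Φ y‖ ∧ ‖Φ x - Φ y‖ ≤ u * ‖x - y‖) :
    (m = n →
      ENNReal.ofReal (σmin ^ 2 / σmax) * reach M ≤ reach (Φ '' M)) ∧
    (m < n →
      ENNReal.ofReal (σmin ^ 2 * l ^ 2 / σmax ^ 3) * reach M ≤ reach (Φ '' M)) := by
  have hmax : 0 < σmax := hσ.trans_le hσ'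
  have hΦ : ∀ x, ‖Φ x‖ ≤ σmax * ‖x‖ := by
    refine Φ.norm_apply_le_of_singularValues_le hmax.le fun i _ ↦ ?_
    -- `hsing` covers only the first `m` singular values; those beyond the rank vanish.
    rcases lt_or_ge i m with hi | hi
    · exact (hsing i hi).2
    · rw [Φ.singularValues_eq_zero_iff_le_finrank_range.2 (hrank.trans_le hi)]
      exact hmax.le
  refine ⟨fun hmn ↦ ?_, fun _ ↦ ?_⟩
  · refine mul_reach_le_reach_image Φ hMc hmax hσ hΦ fun x _ y _ ↦ ?_
    rw [← map_sub]
    refine Φ.le_norm_apply_of_le_singularValues hσ.le (fun i hi ↦ (hsing i ?_).1) _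
    rwa [finrank_euclideanSpace_fin, ← hmn] at hi
  · refine le_trans ?_
      (mul_reach_le_reach_image Φ hMc hmax hl hΦ fun x hx y hy ↦ (hlip x hx y hy).1)
    -- The factor obtained, `l ^ 2 / σmax`, is at least the required one because `σmin ≤ σmax`.
    gcongr ENNReal.ofReal ?_ * _
    rw [div_le_div_iff₀ (by positivity) hmax]
    have h : σmin ^ 2 ≤ σmax ^ 2 := by gcongr
    calc σmin ^ 2 * l ^ 2 * σmax ≤ σmax ^ 2 * l ^ 2 * σmax := by gcongr
      _ = l ^ 2 * σmax ^ 3 := by ring
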